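/- **Theorem (Generalized PASTA).** Let $(M(t))_{t\ge 0}$ be a stochastic process with finite state space $\Omega$ whose sample paths are almost surely left-continuous on $(0,\infty)$ (so that $M(u)$ is the state found by a jump occurring at time $u$). Assume that for every $S\in\Omega$ the limit $\pi_S=\lim_{t\to\infty}\mathbb P(M(t)=S)$ exists and that, almost surely, $\frac1T\int_0^T \mathbf 1(M(u)=S)\,du\to\pi_S$ as $T\to\infty$. For every $S\in\Omega$ let $P_S$ be a Poisson process of rate $\lambda_S\ge 0$ on the same probability space, and assume lack of anticipation: for every $S\in\Omega$ and every $t\ge 0$, the process $\{P_S(t+u)-P_S(t),\ u\ge 0\}$ is independent of the joint past $\{(M(v),P_S(v)),\ 0\le v\le t\}$. (No assumption is made on the joint law of the $P_S$ for different $S$.) Let $Q$ be a process with nondecreasing, right-continuous, $\mathbb N$-valued sample paths whose jumps coincide with those of $P_S$ while $M$ is in state $S$: almost surely, $Q(t)-Q(t-)=P_S(t)-P_S(t-)$ for all $S\in\Omega$ and all $t>0$ with $M(t)=S$. For $B\subseteq\Omega$ put $$Y_B(t)=\frac1t\int_{(0,t]}\mathbf 1\big(M(u)\in B\big)\,dQ(u).$$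 Then for every $B\subseteq\Omega$, almost surely, $$Y_B(t)\longrightarrow\sum_{S\in B}\lambda_S\pi_S\qquad(t\to+\infty).$$ Consequently, for every partition $(B_i)_{1\le i\le l}$ of $B$ and all numbers $\lambda_1,\dots,\lambda_l\ge 0$ such that $\lambda_S=\lambda_i$ for all $S\in B_i$, almost surely $Y_B(t)\to\sum_{i=1}^l\lambda_i\sum_{S\in B_i}\pi_S$ as $t\to+\infty$. -/

import Mathlib

open MeasureTheory ProbabilityTheory Filter Topology Set
open scoped NNReal

noncomputable section

/-- A counting path on `[0, ∞)`: nondecreasing, right-continuous, with values in `ℕ`. -/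
structure IsCountingPath (q : ℝ≥0 → ℕ) : Prop where
  mono : Monotone q
  rightCont : ∀ t, ContinuousWithinAt q (Ici t) t

/-- The jump `q(t) - q(t-)` of a counting path at the time `t`. -/
def jump (q : ℝ≥0 → ℕ) (t : ℝ≥0) : ℕ := q t - Function.leftLim q t

/-- A counting path as a Stieltjes function. -/
def IsCountingPath.stieltjes {q : ℝ≥0 → ℕ} (h : IsCountingPath q) : StieltjesFunction ℝ≥0 where
  toFun t := (q t : ℝ)
  mono' := fun _ _ hst => Nat.cast_le.mpr (h.mono hst)
  right_continuous' := fun t =>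
    (continuous_of_discreteTopology (f := fun n : ℕ => (n : ℝ))).continuousAt.comp_continuousWithinAt
      (h.rightCont t)

open Classical in
/-- The Lebesgue-Stieltjes measure `dq` of a counting path `q`, which gives the mass `q(t) - q(s)`
to the interval `(s, t]`; by convention it is `0` if `q` is not a counting path. -/
def pathMeasure (q : ℝ≥0 → ℕ) : Measure ℝ≥0 :=
  if h : IsCountingPath q then h.stieltjes.measure else 0

variable {Ω 𝓢 : Type*} [MeasurableSpace Ω]

/-- `N` is a homogeneous Poisson process with rate `r` on the probability space `(Ω, P)`. -/
structure IsPoissonProcess (N : ℝ≥0 → Ω → ℕ) (r : ℝ≥0) (P : Measure Ω) : Prop where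
  measurable : ∀ t, Measurable (N t)
  path : ∀ᵐ ω ∂P, IsCountingPath (fun t => N t ω)
  start : ∀ᵐ ω ∂P, N 0 ω = 0
  indep : HasIndepIncrements N P
  law : ∀ s t, s ≤ t → HasLaw (fun ω => N t ω - N s ω) (poissonMeasure (r * (t - s))) P

/-- Lack of anticipation: for every time `t`, the increments of `N` after `t` are independent of
the joint past of `M` and `N` up to and including `t`. -/
def LackOfAnticipation [MeasurableSpace 𝓢] (M : ℝ≥0 → Ω → 𝓢) (N : ℝ≥0 → Ω → ℕ)
    (P : Measure Ω) : Prop :=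
  ∀ t : ℝ≥0, IndepFun (fun ω (u : ℝ≥0) => N (t + u) ω - N t ω)
    (fun ω (v : Iic t) => (M v ω, N v ω)) P

/-- The path `m` is left-continuous on `(0, ∞)` for the discrete topology of the state space. -/
def LeftContinuousPath (m : ℝ≥0 → 𝓢) : Prop :=
  ∀ t, 0 < t → ∀ᶠ u in 𝓝[<] t, m u = m t

/-- The jumps of `q` are, while `m` is in the state `S`, the jumps of `p S`. -/
def JumpsCoincide (m : ℝ≥0 → 𝓢) (p : 𝓢 → ℝ≥0 → ℕ) (q : ℝ≥0 → ℕ) : Prop :=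
  ∀ S t, 0 < t → m t = S → jump q t = jump (p S) t

/-- The fraction `(1/t) ∫₀ᵗ 1(m(u) ∈ B) du` of the time up to `t` that `m` spends in `B`. -/
def timeFraction (m : ℝ≥0 → 𝓢) (B : Set 𝓢) (t : ℝ≥0) : ℝ :=
  1 / (t : ℝ) * ∫ u in (0 : ℝ)..t, (m ⁻¹' B).indicator 1 u.toNNReal

/-- The number `(1/t) ∫₀ᵗ 1(m(u) ∈ B) dq(u)` of times up to `t` that `q` finds `m` in `B`,
normalized by `t`. -/
def arrivalFraction (m : ℝ≥0 → 𝓢) (q : ℝ≥0 → ℕ) (B : Set 𝓢) (t : ℝ≥0) : ℝ :=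
  1 / (t : ℝ) * ∫ u in Ioc 0 t, (m ⁻¹' B).indicator 1 u ∂pathMeasure q

end

/-! The jumps of `Q` in state `S` are those of `N S`, so the arrivals that find `M` in `B` split
pathwise into a finite sum over `S ∈ B` (`arrivalFraction_eq_sum`). The joint law of the `N S` plays
no role, and it suffices to treat one state.

For one state, the compensated count D(T) = ∫ 1(M = S) dN - r ∫ 1(M = S) du is the pathwise limit of
left-endpoint Riemann sums, because `M` is left-continuous. Lack of anticipation makes their terms
orthogonal (`LackOfAnticipation.integral_martingaleIncrement_mul`), so their second moments are at
most rT whatever the mesh, and Fatou passes this bound to D(T). Along T = (n+1)² the expectations of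
(D(T)/T)² are summable, hence D(T)/T → 0 almost surely. The time-average hypothesis then gives the
limit along squares, and monotonicity of the count extends it to all t
(`tendsto_div_of_tendsto_div_sq`). -/

noncomputable section

/-! ### Left-endpoint grids and Riemann-Stieltjes sums -/

/-- The largest point of the grid `ℕ / (n + 1)` that lies strictly before `u` (and `0` if there
is none). -/
def gridLeft (n : ℕ) (u : ℝ≥0) : ℝ≥0 := ((⌈u * (n + 1)⌉₊ - 1 : ℕ) : ℝ≥0) / (n + 1)

lemma gridLeft_zero (n : ℕ) : gridLeft n 0 = 0 := by simp [gridLeft]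

lemma gridLeft_of_mem {n k : ℕ} {u : ℝ≥0}
    (hu : u ∈ Ioc ((k : ℝ≥0) / (n + 1)) (((k + 1 : ℕ) : ℝ≥0) / (n + 1))) :
    gridLeft n u = (k : ℝ≥0) / (n + 1) := by
  have hn : (0 : ℝ≥0) < n + 1 := by positivity
  have h1 : (k : ℝ≥0) < u * (n + 1) := (div_lt_iff₀ hn).1 hu.1
  have h2 : u * (n + 1) ≤ ((k + 1 : ℕ) : ℝ≥0) := (le_div_iff₀ hn).1 hu.2
  have h3 : ⌈u * (n + 1)⌉₊ = k + 1 := by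
    apply le_antisymm (Nat.ceil_le.2 h2)
    exact Nat.succ_le_of_lt (Nat.lt_ceil.2 h1)
  rw [gridLeft, h3, Nat.add_sub_cancel]

lemma gridLeft_lt {n : ℕ} {u : ℝ≥0} (hu : 0 < u) : gridLeft n u < u := by
  have hn : (0 : ℝ≥0) < n + 1 := by positivity
  rw [gridLeft, div_lt_iff₀ hn, ← Nat.lt_ceil]
  have : 0 < ⌈u * (n + 1)⌉₊ := Nat.ceil_pos.2 (by positivity)
  omega

lemma le_gridLeft_add (n : ℕ) (u : ℝ≥0) : u ≤ gridLeft n u + 1 / (n + 1) := by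
  have hn : (0 : ℝ≥0) < n + 1 := by positivity
  rw [gridLeft, ← add_div, le_div_iff₀ hn]
  refine (Nat.le_ceil _).trans ?_
  exact_mod_cast (by omega : ⌈u * (n + 1)⌉₊ ≤ ⌈u * (n + 1)⌉₊ - 1 + 1)

lemma tendsto_gridLeft {u : ℝ≥0} (hu : 0 < u) :
    Tendsto (fun n => gridLeft n u) atTop (𝓝[<] u) := by
  refine tendsto_nhdsWithin_iff.2 ⟨?_, Eventually.of_forall fun n => gridLeft_lt hu⟩
  have h : Tendsto (fun n : ℕ => (u : ℝ) - 1 / ((n : ℝ) + 1)) atTop (𝓝 (u : ℝ)) := by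
    simpa using tendsto_const_nhds.sub (tendsto_one_div_add_atTop_nhds_zero_nat (𝕜 := ℝ))
  rw [← NNReal.tendsto_coe]
  refine tendsto_of_tendsto_of_tendsto_of_le_of_le h tendsto_const_nhds (fun n => ?_) fun n => ?_
  · have := NNReal.coe_le_coe.2 (le_gridLeft_add n u)
    push_cast at this
    simp only
    linarith
  · exact NNReal.coe_le_coe.2 (gridLeft_lt hu).le

/-- No regularity of `f` is needed: the composite factors through the ceiling, a measurable map into
the countable space `ℕ`. -/
lemma measurable_comp_gridLeft {E : Type*} [MeasurableSpace E] (n : ℕ) (f : ℝ≥0 → E) :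
    Measurable (fun u => f (gridLeft n u)) := by
  have h : Measurable (fun k : ℕ => f (((k - 1 : ℕ) : ℝ≥0) / (n + 1))) := measurable_of_countable _
  exact h.comp (Nat.measurable_ceil.comp (measurable_id.mul_const _))

lemma tendsto_comp_gridLeft {f : ℝ≥0 → ℝ} (hf : LeftContinuousPath f) (u : ℝ≥0) :
    Tendsto (fun n => f (gridLeft n u)) atTop (𝓝 (f u)) := by
  -- Left-continuity says nothing at 0, but there the grid point is 0 itself.
  rcases eq_or_ne u 0 with rfl | hu
  · simp [gridLeft_zero]
  · have hu := pos_of_ne_zero hu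
    exact tendsto_nhds_of_eventually_eq ((tendsto_gridLeft hu).eventually (hf u hu))

lemma LeftContinuousPath.measurable {f : ℝ≥0 → ℝ} (hf : LeftContinuousPath f) : Measurable f :=
  measurable_of_tendsto_metrizable (fun n => measurable_comp_gridLeft n f)
    (tendsto_pi_nhds.2 (tendsto_comp_gridLeft hf))

lemma integrableOn_comp_gridLeft {f : ℝ≥0 → ℝ} (hb : ∀ u, ‖f u‖ ≤ 1) (μ : Measure ℝ≥0)
    [IsLocallyFiniteMeasure μ] (n : ℕ) (a b : ℝ≥0) :
    IntegrableOn (fun u => f (gridLeft n u)) (Ioc a b) μ :=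
  have : IsFiniteMeasure (μ.restrict (Ioc a b)) := ⟨by simpa using measure_Ioc_lt_top⟩
  Integrable.of_bound (measurable_comp_gridLeft n f).aestronglyMeasurable 1
    (Eventually.of_forall fun _ => hb _)

lemma setIntegral_comp_gridLeft {f : ℝ≥0 → ℝ} (hb : ∀ u, ‖f u‖ ≤ 1) (μ : Measure ℝ≥0)
    [IsLocallyFiniteMeasure μ] (n K : ℕ) :
    ∫ u in Ioc 0 ((K : ℝ≥0) / (n + 1)), f (gridLeft n u) ∂μ =
      ∑ k ∈ Finset.range K, f ((k : ℝ≥0) / (n + 1)) *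
        μ.real (Ioc ((k : ℝ≥0) / (n + 1)) (((k + 1 : ℕ) : ℝ≥0) / (n + 1))) := by
  induction K with
  | zero => simp
  | succ K ih =>
    have hle : (K : ℝ≥0) / (n + 1) ≤ ((K + 1 : ℕ) : ℝ≥0) / (n + 1) := by
      gcongr
      exact Nat.le_succ K
    rw [← Ioc_union_Ioc_eq_Ioc (zero_le (a := (K : ℝ≥0) / (n + 1))) hle,
      setIntegral_union (Ioc_disjoint_Ioc_of_le le_rfl) measurableSet_Ioc
        (integrableOn_comp_gridLeft hb μ n _ _) (integrableOn_comp_gridLeft hb μ n _ _), ih,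
      Finset.sum_range_succ]
    congr 1
    rw [setIntegral_congr_fun measurableSet_Ioc
      (g := fun _ => f ((K : ℝ≥0) / (n + 1))) fun u hu => by simp only [gridLeft_of_mem hu]]
    simp [mul_comm]

/-- Riemann-Stieltjes sums of left-continuous paths converge to the integral. -/
lemma tendsto_riemannSum {f : ℝ≥0 → ℝ} (hf : LeftContinuousPath f) (hb : ∀ u, ‖f u‖ ≤ 1)
    (μ : Measure ℝ≥0) [IsLocallyFiniteMeasure μ] (T : ℕ) :
    Tendsto (fun n : ℕ => ∑ k ∈ Finset.range (T * (n + 1)), f ((k : ℝ≥0) / (n + 1)) *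
        μ.real (Ioc ((k : ℝ≥0) / (n + 1)) (((k + 1 : ℕ) : ℝ≥0) / (n + 1)))) atTop
      (𝓝 (∫ u in Ioc 0 (T : ℝ≥0), f u ∂μ)) := by
  have h : Tendsto (fun n : ℕ => ∫ u in Ioc 0 (T : ℝ≥0), f (gridLeft n u) ∂μ) atTop
      (𝓝 (∫ u in Ioc 0 (T : ℝ≥0), f u ∂μ)) := by
    refine tendsto_integral_of_dominated_convergence (fun _ => 1)
      (fun n => (measurable_comp_gridLeft n f).aestronglyMeasurable) ?_
      (fun n => Eventually.of_forall fun _ => hb _)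
      (Eventually.of_forall (tendsto_comp_gridLeft hf))
    exact integrableOn_const measure_Ioc_lt_top.ne
  refine h.congr fun n => ?_
  rw [← setIntegral_comp_gridLeft hb]
  congr 3
  push_cast
  rw [mul_div_cancel_right₀]
  positivity

/-! ### Occupation indicators and path integrals -/

/-- The indicator of the times at which a path is in the state `S`. -/
def occupation {𝓢 : Type*} (m : ℝ≥0 → 𝓢) (S : 𝓢) : ℝ≥0 → ℝ := (m ⁻¹' {S}).indicator 1

section
variable {𝓢 : Type*} {m : ℝ≥0 → 𝓢} {S : 𝓢}

lemma occupation_nonneg (m : ℝ≥0 → 𝓢) (S : 𝓢) (u : ℝ≥0) : 0 ≤ occupation m S u :=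
  indicator_nonneg (fun _ _ => zero_le_one) _

lemma occupation_le_one (m : ℝ≥0 → 𝓢) (S : 𝓢) (u : ℝ≥0) : occupation m S u ≤ 1 :=
  indicator_le_self' (fun _ _ => zero_le_one) _

lemma norm_occupation_le (m : ℝ≥0 → 𝓢) (S : 𝓢) (u : ℝ≥0) : ‖occupation m S u‖ ≤ 1 := by
  rw [Real.norm_of_nonneg (occupation_nonneg m S u)]
  exact occupation_le_one m S u

lemma LeftContinuousPath.occupation (hm : LeftContinuousPath m) (S : 𝓢) :
    LeftContinuousPath (occupation m S) := by
  intro t ht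
  filter_upwards [hm t ht] with u hu
  have h : u ∈ m ⁻¹' {S} ↔ t ∈ m ⁻¹' {S} := by rw [mem_preimage, mem_preimage, hu]
  by_cases hS : t ∈ m ⁻¹' {S} <;> simp [_root_.occupation, indicator, h, hS]

lemma LeftContinuousPath.measurableSet (hm : LeftContinuousPath m) (S : 𝓢) :
    MeasurableSet (m ⁻¹' {S}) := by
  have h := (hm.occupation S).measurable (measurableSet_singleton 1)
  convert h using 1
  ext u
  by_cases hu : m u = S <;> simp [_root_.occupation, hu]

lemma IsCountingPath.pathMeasure_eq {q : ℝ≥0 → ℕ} (h : IsCountingPath q) :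
    pathMeasure q = h.stieltjes.measure := dif_pos h

instance (q : ℝ≥0 → ℕ) : IsLocallyFiniteMeasure (pathMeasure q) := by
  by_cases h : IsCountingPath q
  · rw [h.pathMeasure_eq]; infer_instance
  · rw [pathMeasure, dif_neg h]; infer_instance

lemma IsCountingPath.pathMeasure_Ioc {q : ℝ≥0 → ℕ} (h : IsCountingPath q) {a b : ℝ≥0}
    (hab : a ≤ b) : (pathMeasure q).real (Ioc a b) = ((q b - q a : ℕ) : ℝ) := by
  have h' : (q a : ℝ) ≤ q b := Nat.cast_le.2 (h.mono hab)
  rw [h.pathMeasure_eq, measureReal_def, StieltjesFunction.measure_Ioc, Nat.cast_sub (h.mono hab)]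
  exact ENNReal.toReal_ofReal (sub_nonneg.2 h')

lemma tendsto_pathIntegral (hm : LeftContinuousPath m) (S : 𝓢) {q : ℝ≥0 → ℕ}
    (hq : IsCountingPath q) (T : ℕ) :
    Tendsto (fun n : ℕ => ∑ k ∈ Finset.range (T * (n + 1)), occupation m S ((k : ℝ≥0) / (n + 1)) *
        ((q (((k + 1 : ℕ) : ℝ≥0) / (n + 1)) - q ((k : ℝ≥0) / (n + 1)) : ℕ) : ℝ)) atTop
      (𝓝 (∫ u in Ioc 0 (T : ℝ≥0), occupation m S u ∂pathMeasure q)) := by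
  refine (tendsto_riemannSum (hm.occupation S) (norm_occupation_le m S) (pathMeasure q) T).congr
    fun n => Finset.sum_congr rfl fun k _ => ?_
  rw [hq.pathMeasure_Ioc]
  gcongr
  exact Nat.le_succ k

lemma tendsto_timeIntegral (hm : LeftContinuousPath m) (S : 𝓢) (T : ℕ) :
    Tendsto (fun n : ℕ => ∑ k ∈ Finset.range (T * (n + 1)), occupation m S ((k : ℝ≥0) / (n + 1)) *
        (1 / ((n : ℝ) + 1))) atTop
      (𝓝 (∫ u in (0 : ℝ)..T, occupation m S u.toNNReal)) := by
  have hT : (0 : ℝ) ≤ T := Nat.cast_nonneg T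
  -- Lebesgue measure is cut to (0, T] before being pushed to `ℝ≥0`; otherwise the negative
  -- half-line would collapse to an infinite atom at 0.
  have h := tendsto_riemannSum (hm.occupation S) (norm_occupation_le m S)
    ((volume.restrict (Ioc (0 : ℝ) T)).map Real.toNNReal) T
  have hpre : ∀ a b : ℝ≥0, Real.toNNReal ⁻¹' Ioc a b = Ioc (a : ℝ) b := by
    intro a b
    ext x
    simp only [mem_preimage, mem_Ioc, Real.toNNReal_le_iff_le_coe, Real.lt_toNNReal_iff_coe_lt]
  rw [setIntegral_map measurableSet_Ioc (hm.occupation S).measurable.aestronglyMeasurable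
    measurable_real_toNNReal.aemeasurable, hpre, Measure.restrict_restrict measurableSet_Ioc,
    NNReal.coe_zero, NNReal.coe_natCast, inter_self, ← intervalIntegral.integral_of_le hT] at h
  refine h.congr fun n => Finset.sum_congr rfl fun k hk => ?_
  have hn : (0 : ℝ) < n + 1 := by positivity
  have hk' : ((k + 1 : ℕ) : ℝ) ≤ T * ((n : ℝ) + 1) := by
    exact_mod_cast Nat.succ_le_of_lt (Finset.mem_range.1 hk)
  rw [map_measureReal_apply measurable_real_toNNReal measurableSet_Ioc, hpre,
    measureReal_restrict_apply measurableSet_Ioc, inter_eq_left.2]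
  · rw [Real.volume_real_Ioc_of_le]
    · congr 1
      push_cast
      ring
    · push_cast
      gcongr
      linarith
  · refine Ioc_subset_Ioc (by positivity) ?_
    push_cast at hk' ⊢
    rwa [div_le_iff₀ hn]

/-! ### Path measures as sums of jumps -/

lemma neBot_nhdsLT_of_pos {t : ℝ≥0} (ht : 0 < t) : (𝓝[<] t).NeBot :=
  nhdsLT_neBot_of_exists_lt ⟨0, ht⟩

/-- The mass of a counting path at a positive time is its jump. -/
lemma IsCountingPath.pathMeasure_singleton {q : ℝ≥0 → ℕ} (h : IsCountingPath q) {t : ℝ≥0}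
    (ht : 0 < t) : pathMeasure q {t} = jump q t := by
  have := neBot_nhdsLT_of_pos ht
  have h2 : Function.leftLim h.stieltjes t = ((Function.leftLim q t : ℕ) : ℝ) :=
    leftLim_eq_of_tendsto
      ((continuous_of_discreteTopology (f := fun n : ℕ => (n : ℝ))).continuousAt.tendsto.comp
        (h.mono.tendsto_leftLim t))
  rw [h.pathMeasure_eq, StieltjesFunction.measure_singleton, h2, jump, ← ENNReal.ofReal_natCast,
    Nat.cast_sub (h.mono.leftLim_le le_rfl)]
  rfl

/-- Away from its jumps, a counting path has no mass. -/
lemma IsCountingPath.pathMeasure_setOf_jump_eq_zero {q : ℝ≥0 → ℕ} (h : IsCountingPath q) :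
    pathMeasure q {t | 0 < t ∧ jump q t = 0} = 0 := by
  refine measure_null_of_locally_null _ fun t ht => ?_
  obtain ⟨ht, hj⟩ := ht
  have := neBot_nhdsLT_of_pos ht
  have hl : Function.leftLim q t = q t :=
    le_antisymm (h.mono.leftLim_le le_rfl) (Nat.sub_eq_zero_iff_le.1 hj)
  have hlt : ∀ᶠ u in 𝓝[<] t, q u = q t := by
    have := h.mono.tendsto_leftLim t
    rw [hl, nhds_discrete, tendsto_pure] at this
    exact this
  have hge : ∀ᶠ u in 𝓝[≥] t, q u = q t := by
    have := h.rightCont t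
    rw [ContinuousWithinAt, nhds_discrete, tendsto_pure] at this
    exact this
  have hall : ∀ᶠ u in 𝓝 t, q u = q t := by
    rw [← nhdsLT_sup_nhdsGE]
    exact eventually_sup.2 ⟨hlt, hge⟩
  -- `q` is constant near `t`, so a small half-open interval around `t` has mass `q b' - q a' = 0`.
  obtain ⟨a, b, ⟨hat, htb⟩, hab⟩ :=
    (mem_nhds_iff_exists_Ioo_subset' ⟨0, ht⟩ ⟨t + 1, lt_add_one t⟩).1 hall
  obtain ⟨a', ha, hat'⟩ := exists_between hat
  obtain ⟨b', htb', hb⟩ := exists_between htb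
  refine ⟨Ioc a' b', mem_nhdsWithin_of_mem_nhds (Ioc_mem_nhds hat' htb'), ?_⟩
  have ha' : q a' = q t := hab ⟨ha, hat'.trans htb⟩
  have hb' : q b' = q t := hab ⟨hat.trans htb', hb⟩
  have := h.pathMeasure_Ioc (hat'.trans htb').le
  rw [ha', hb', Nat.sub_self, Nat.cast_zero, measureReal_eq_zero_iff measure_Ioc_lt_top.ne] at this
  exact this

lemma IsCountingPath.countable_jump_ne_zero {q : ℝ≥0 → ℕ} (h : IsCountingPath q) :
    {t | 0 < t ∧ jump q t ≠ 0}.Countable := by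
  refine h.stieltjes.countable_leftLim_ne.mono ?_
  rintro t ⟨ht, hj⟩ heq
  refine hj ?_
  have h1 := h.pathMeasure_singleton ht
  rw [h.pathMeasure_eq, StieltjesFunction.measure_singleton, heq, sub_self,
    ENNReal.ofReal_zero] at h1
  exact_mod_cast h1.symm

/-- The measure of a counting path is the sum of its jumps. -/
lemma IsCountingPath.pathMeasure_eq_tsum {q : ℝ≥0 → ℕ} (h : IsCountingPath q) {s : Set ℝ≥0}
    (hs : s ⊆ Ioi 0) : pathMeasure q s = ∑' t : s, (jump q t : ENNReal) := by
  -- `s` need not be measurable: it is a countable set of jump times together with a null remainder.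
  have hc : (s ∩ {t | jump q t ≠ 0}).Countable :=
    h.countable_jump_ne_zero.mono (by rintro t ⟨ht, hj⟩; exact ⟨hs ht, hj⟩)
  have h0 : pathMeasure q (s \ (s ∩ {t | jump q t ≠ 0})) = 0 := by
    refine measure_mono_null ?_ h.pathMeasure_setOf_jump_eq_zero
    rintro t ⟨ht, ht'⟩
    exact ⟨hs ht, by_contra fun hj => ht' ⟨ht, hj⟩⟩
  have h1 : pathMeasure q s = pathMeasure q (s ∩ {t | jump q t ≠ 0}) := by
    refine le_antisymm ?_ (measure_mono inter_subset_left)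
    have := measure_le_inter_add_sdiff (pathMeasure q) s (s ∩ {t | jump q t ≠ 0})
    rwa [h0, add_zero, ← inter_assoc, inter_self] at this
  rw [h1, ← biUnion_of_singleton (s ∩ {t | jump q t ≠ 0}), measure_biUnion hc
    (fun a _ b _ hab => disjoint_singleton.2 hab) fun _ _ => measurableSet_singleton _]
  have h2 : ∀ t : ↥(s ∩ {t | jump q t ≠ 0}), pathMeasure q {(t : ℝ≥0)} = (jump q t : ENNReal) :=
    fun t => h.pathMeasure_singleton (hs t.2.1)
  simp only [h2]
  rw [tsum_subtype (s ∩ {t | jump q t ≠ 0}) fun t => (jump q t : ENNReal),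
    tsum_subtype s fun t => (jump q t : ENNReal)]
  refine tsum_congr fun t => ?_
  by_cases hts : t ∈ s <;> by_cases hj : jump q t = 0 <;> simp [indicator, hts, hj]

/-- Both measures are sums of jumps, and these agree at positive times spent in `S`. Time 0 is
removed because `JumpsCoincide` is silent there. -/
lemma JumpsCoincide.restrict_pathMeasure {p : 𝓢 → ℝ≥0 → ℕ} {q : ℝ≥0 → ℕ}
    (hc : JumpsCoincide m p q) (hq : IsCountingPath q) (hp : IsCountingPath (p S)) :
    (pathMeasure q).restrict (m ⁻¹' {S} ∩ Ioi 0) =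
      (pathMeasure (p S)).restrict (m ⁻¹' {S} ∩ Ioi 0) := by
  ext A hA
  have hsub : A ∩ (m ⁻¹' {S} ∩ Ioi 0) ⊆ Ioi 0 := fun t ht => ht.2.2
  rw [Measure.restrict_apply hA, Measure.restrict_apply hA, hq.pathMeasure_eq_tsum hsub,
    hp.pathMeasure_eq_tsum hsub]
  exact tsum_congr fun t => by rw [hc S t t.2.2.2 t.2.2.1]

lemma JumpsCoincide.setIntegral_occupation {p : 𝓢 → ℝ≥0 → ℕ} {q : ℝ≥0 → ℕ}
    (hc : JumpsCoincide m p q) (hq : IsCountingPath q) (hp : IsCountingPath (p S))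
    (hm : LeftContinuousPath m) (t : ℝ≥0) :
    ∫ u in Ioc 0 t, occupation m S u ∂pathMeasure q =
      ∫ u in Ioc 0 t, occupation m S u ∂pathMeasure (p S) := by
  have hS := hm.measurableSet S
  have key := congrArg (fun μ => μ.restrict (Ioc 0 t)) (hc.restrict_pathMeasure hq hp)
  simp only [Measure.restrict_restrict measurableSet_Ioc] at key
  have hset : Ioc 0 t ∩ (m ⁻¹' {S} ∩ Ioi 0) = Ioc 0 t ∩ m ⁻¹' {S} := by
    ext u
    simp only [mem_inter_iff, mem_Ioc, mem_Ioi]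
    tauto
  rw [hset] at key
  simp only [occupation]
  rw [setIntegral_indicator hS, setIntegral_indicator hS, key]

lemma integrableOn_occupation (hm : LeftContinuousPath m) (μ : Measure ℝ≥0)
    [IsLocallyFiniteMeasure μ] (t : ℝ≥0) : IntegrableOn (occupation m S) (Ioc 0 t) μ :=
  have : IsFiniteMeasure (μ.restrict (Ioc 0 t)) := ⟨by simpa using measure_Ioc_lt_top⟩
  Integrable.of_bound (hm.occupation S).measurable.aestronglyMeasurable 1
    (Eventually.of_forall fun _ => norm_occupation_le m S _)

lemma arrivalFraction_eq_sum {p : 𝓢 → ℝ≥0 → ℕ} {q : ℝ≥0 → ℕ}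
    (hc : JumpsCoincide m p q) (hq : IsCountingPath q) (hp : ∀ S, IsCountingPath (p S))
    (hm : LeftContinuousPath m) (B : Finset 𝓢) (t : ℝ≥0) :
    arrivalFraction m q B t = ∑ S ∈ B, arrivalFraction m (p S) {S} t := by
  have hB : (m ⁻¹' (B : Set 𝓢)).indicator (1 : ℝ≥0 → ℝ) = fun u => ∑ S ∈ B, occupation m S u := by
    ext u
    classical
    simp [occupation, indicator, eq_comm]
  simp only [arrivalFraction, hB]
  rw [integral_finsetSum _ fun S _ => integrableOn_occupation hm _ t, Finset.mul_sum]
  exact Finset.sum_congr rfl fun S _ => by rw [hc.setIntegral_occupation hq (hp S) hm]; rfl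

end

/-! ### Centered moments of the Poisson law -/

section Poisson
open scoped Nat

lemma hasSum_poisson_factorialMoment_one (r : ℝ≥0) :
    HasSum (fun n : ℕ => Real.exp (-r) * (r : ℝ) ^ n / n ! * (n : ℝ)) r := by
  rw [← hasSum_nat_add_iff' 1]
  simp only [Finset.range_one, Finset.sum_singleton, Nat.cast_zero, mul_zero, sub_zero]
  have h := (hasSum_one_poissonMeasure r).mul_left (r : ℝ)
  rw [mul_one] at h
  refine (congrArg (HasSum · _) (funext fun n => ?_)).mp h
  rw [Nat.factorial_succ]
  push_cast
  have : (n ! : ℝ) ≠ 0 := by positivity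
  field_simp
  ring

/-- Shifting the index by one cancels a factor against the factorial and leaves `r` times the first
moment. -/
lemma hasSum_poisson_factorialMoment_two (r : ℝ≥0) :
    HasSum (fun n : ℕ => Real.exp (-r) * (r : ℝ) ^ n / n ! * ((n : ℝ) * (n - 1))) ((r : ℝ) ^ 2) := by
  rw [← hasSum_nat_add_iff' 1]
  simp only [Finset.range_one, Finset.sum_singleton, Nat.cast_zero, mul_zero, zero_mul, sub_zero]
  have h := (hasSum_poisson_factorialMoment_one r).mul_left (r : ℝ)
  rw [← sq] at h
  refine (congrArg (HasSum · _) (funext fun n => ?_)).mp h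
  rw [Nat.factorial_succ]
  push_cast
  have : (n ! : ℝ) ≠ 0 := by positivity
  field_simp
  ring

lemma hasSum_poisson_centered (r : ℝ≥0) :
    HasSum (fun n : ℕ => Real.exp (-r) * (r : ℝ) ^ n / n ! * ((n : ℝ) - r)) 0 := by
  have h := (hasSum_poisson_factorialMoment_one r).sub
    ((hasSum_one_poissonMeasure r).mul_right (r : ℝ))
  rw [one_mul, sub_self] at h
  exact (congrArg (HasSum · _) (funext fun n => by ring)).mp h

lemma hasSum_poisson_centered_sq (r : ℝ≥0) :
    HasSum (fun n : ℕ => Real.exp (-r) * (r : ℝ) ^ n / n ! * ((n : ℝ) - r) ^ 2) r := by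
  -- (n - r)² = n(n - 1) + (1 - 2r)n + r².
  have h := ((hasSum_poisson_factorialMoment_two r).add
    ((hasSum_poisson_factorialMoment_one r).mul_left (1 - 2 * (r : ℝ)))).add
    ((hasSum_one_poissonMeasure r).mul_right ((r : ℝ) ^ 2))
  rw [show (r : ℝ) ^ 2 + (1 - 2 * r) * r + 1 * r ^ 2 = r by ring] at h
  exact (congrArg (HasSum · _) (funext fun n => by ring)).mp h

lemma integral_poissonMeasure_centered (r : ℝ≥0) :
    ∫ n : ℕ, ((n : ℝ) - r) ∂poissonMeasure r = 0 := by
  rw [integral_poissonMeasure]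
  exact (hasSum_poisson_centered r).tsum_eq

lemma integral_poissonMeasure_centered_sq (r : ℝ≥0) :
    ∫ n : ℕ, ((n : ℝ) - r) ^ 2 ∂poissonMeasure r = r := by
  rw [integral_poissonMeasure]
  exact (hasSum_poisson_centered_sq r).tsum_eq

lemma memLp_poissonMeasure_centered (r : ℝ≥0) :
    MemLp (fun n : ℕ => (n : ℝ) - r) 2 (poissonMeasure r) := by
  rw [memLp_two_iff_integrable_sq (measurable_of_countable _).aestronglyMeasurable,
    integrable_poissonMeasure_iff]
  simpa using (hasSum_poisson_centered_sq r).summable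

end Poisson

/-! ### Orthogonal increments and the second-moment bound -/

section
variable {Ω : Type*} [MeasurableSpace Ω] {P : Measure Ω}

lemma memLp_of_hasLaw_poissonMeasure {X : Ω → ℕ} {r : ℝ≥0} (hX : HasLaw X (poissonMeasure r) P) :
    MemLp (fun ω => (X ω : ℝ) - r) 2 P := by
  have h := memLp_poissonMeasure_centered r
  rw [← hX.map_eq] at h
  exact h.comp_of_map hX.aemeasurable

lemma integral_of_hasLaw_poissonMeasure {X : Ω → ℕ} {r : ℝ≥0}
    (hX : HasLaw X (poissonMeasure r) P) : ∫ ω, ((X ω : ℝ) - r) ∂P = 0 :=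
  (hX.integral_comp (measurable_of_countable fun n : ℕ => (n : ℝ) - r).aestronglyMeasurable).trans
    (integral_poissonMeasure_centered r)

lemma integral_sq_of_hasLaw_poissonMeasure {X : Ω → ℕ} {r : ℝ≥0}
    (hX : HasLaw X (poissonMeasure r) P) : ∫ ω, ((X ω : ℝ) - r) ^ 2 ∂P = r :=
  (hX.integral_comp
    (measurable_of_countable fun n : ℕ => ((n : ℝ) - r) ^ 2).aestronglyMeasurable).trans
    (integral_poissonMeasure_centered_sq r)

/-- The second moment of a sum of orthogonal random variables. -/
lemma integral_sq_sum_le {Z : ℕ → Ω → ℝ} (hZ : ∀ k, MemLp (Z k) 2 P) {c : ℝ}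
    (hc : ∀ k, ∫ ω, Z k ω ^ 2 ∂P ≤ c) (horth : ∀ j k, j < k → ∫ ω, Z j ω * Z k ω ∂P = 0) (K : ℕ) :
    ∫ ω, (∑ k ∈ Finset.range K, Z k ω) ^ 2 ∂P ≤ K * c := by
  induction K with
  | zero => simp
  | succ K ih =>
    have hS : MemLp (fun ω => ∑ k ∈ Finset.range K, Z k ω) 2 P :=
      memLp_finsetSum _ fun k _ => hZ k
    have hcross : ∀ k, Integrable (fun ω => Z k ω * Z K ω) P :=
      fun k => (hZ k).integrable_mul (hZ K)
    have h0 : ∫ ω, (∑ k ∈ Finset.range K, Z k ω) * Z K ω ∂P = 0 := by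
      simp_rw [Finset.sum_mul]
      rw [integral_finsetSum _ fun k _ => hcross k]
      exact Finset.sum_eq_zero fun k hk => horth k K (Finset.mem_range.1 hk)
    have hexp : ∀ ω, (∑ k ∈ Finset.range (K + 1), Z k ω) ^ 2 =
        (∑ k ∈ Finset.range K, Z k ω) ^ 2 + 2 * ((∑ k ∈ Finset.range K, Z k ω) * Z K ω) +
          Z K ω ^ 2 := by
      intro ω
      rw [Finset.sum_range_succ]
      ring
    have hint : Integrable (fun ω => 2 * ((∑ k ∈ Finset.range K, Z k ω) * Z K ω)) P :=
      (hS.integrable_mul (hZ K)).const_mul 2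
    simp_rw [hexp]
    have h1 := integral_add (hS.integrable_sq.add hint) (hZ K).integrable_sq
    simp only [Pi.add_apply] at h1
    rw [h1, integral_add hS.integrable_sq hint, integral_const_mul, h0]
    push_cast
    linarith [hc K]

lemma occupation_eq {𝓢 : Type*} (m : ℝ≥0 → 𝓢) (S : 𝓢) (u : ℝ≥0) :
    occupation m S u = ({S} : Set 𝓢).indicator 1 (m u) := rfl

variable {𝓢 : Type*} [MeasurableSpace 𝓢] [MeasurableSingletonClass 𝓢]
  {M : ℝ≥0 → Ω → 𝓢} {N : ℝ≥0 → Ω → ℕ} {r : ℝ≥0} {S : 𝓢}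

/-- The centered increment of the counting process `N` over the interval `(s, t]`, counted if
the state at the time `s` is `S`. -/
def martingaleIncrement (M : ℝ≥0 → Ω → 𝓢) (N : ℝ≥0 → Ω → ℕ) (r : ℝ≥0) (S : 𝓢) (s t : ℝ≥0)
    (ω : Ω) : ℝ :=
  occupation (fun u => M u ω) S s * (((N t ω - N s ω : ℕ) : ℝ) - (r * (t - s) : ℝ≥0))

lemma measurable_indicator_singleton (S : 𝓢) : Measurable (({S} : Set 𝓢).indicator (1 : 𝓢 → ℝ)) :=
  measurable_one.indicator (measurableSet_singleton S)

lemma measurable_occupation (hM : ∀ t, Measurable (M t)) (t : ℝ≥0) :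
    Measurable fun ω => occupation (fun u => M u ω) S t :=
  (measurable_indicator_singleton S).comp (hM t)

lemma IsPoissonProcess.memLp_martingaleIncrement (hN : IsPoissonProcess N r P)
    (hM : ∀ t, Measurable (M t)) {s t : ℝ≥0} (hst : s ≤ t) :
    MemLp (martingaleIncrement M N r S s t) 2 P := by
  have h := memLp_of_hasLaw_poissonMeasure (hN.law s t hst)
  refine h.mono ((measurable_occupation hM s).aestronglyMeasurable.mul h.1)
    (Eventually.of_forall fun ω => ?_)
  rw [martingaleIncrement, norm_mul]
  exact mul_le_of_le_one_left (norm_nonneg _) (norm_occupation_le _ _ _)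

lemma IsPoissonProcess.integral_sq_martingaleIncrement_le (hN : IsPoissonProcess N r P)
    (hM : ∀ t, Measurable (M t)) {s t : ℝ≥0} (hst : s ≤ t) :
    ∫ ω, martingaleIncrement M N r S s t ω ^ 2 ∂P ≤ (r * (t - s) : ℝ≥0) := by
  rw [← integral_sq_of_hasLaw_poissonMeasure (hN.law s t hst)]
  refine integral_mono (hN.memLp_martingaleIncrement hM hst).integrable_sq
    (memLp_of_hasLaw_poissonMeasure (hN.law s t hst)).integrable_sq fun ω => ?_
  simp only [martingaleIncrement, mul_pow]
  exact mul_le_of_le_one_left (sq_nonneg _)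
    (pow_le_one₀ (occupation_nonneg _ _ _) (occupation_le_one _ _ _))

/-- The earlier increment and the indicator at `s'` depend on the past up to `s'`, while the later
increment of `N` is independent of that past; the expectation factors, and the centered factor has
mean zero. Sampling the state at the left endpoint is essential. -/
lemma LackOfAnticipation.integral_martingaleIncrement_mul (hLAA : LackOfAnticipation M N P)
    (hN : IsPoissonProcess N r P) (hM : ∀ t, Measurable (M t)) {s t s' t' : ℝ≥0}
    (hst : s ≤ t) (hts : t ≤ s') (hst' : s' ≤ t') :
    ∫ ω, martingaleIncrement M N r S s t ω * martingaleIncrement M N r S s' t' ω ∂P = 0 := by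
  let φ : (ℝ≥0 → ℕ) → ℝ := fun x => (x (t' - s') : ℝ) - (r * (t' - s') : ℝ≥0)
  let ψ : (Iic s' → 𝓢 × ℕ) → ℝ := fun y =>
    ({S} : Set 𝓢).indicator 1 (y ⟨s, hst.trans hts⟩).1 *
      ((((y ⟨t, hts⟩).2 - (y ⟨s, hst.trans hts⟩).2 : ℕ) : ℝ) - (r * (t - s) : ℝ≥0)) *
      ({S} : Set 𝓢).indicator 1 (y ⟨s', self_mem_Iic⟩).1
  have hcast : Measurable (Nat.cast : ℕ → ℝ) := measurable_of_countable _
  have hφ : Measurable φ := (hcast.comp (measurable_pi_apply _)).sub_const _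
  have hψ : Measurable ψ := by
    have hS := measurable_indicator_singleton S
    have hsub : Measurable fun x : ℕ × ℕ => ((x.1 - x.2 : ℕ) : ℝ) := measurable_of_countable _
    exact ((hS.comp (measurable_pi_apply _).fst).mul
      ((hsub.comp ((measurable_pi_apply _).snd.prodMk (measurable_pi_apply _).snd)).sub_const
        _)).mul (hS.comp (measurable_pi_apply _).fst)
  have hind := ((hLAA s').comp hφ hψ).symm
  have hpast : Measurable fun ω (v : Iic s') => (M v ω, N v ω) :=
    measurable_pi_lambda _ fun v => (hM v).prodMk (hN.measurable v)
  have hfut : Measurable fun ω (u : ℝ≥0) => N (s' + u) ω - N s' ω := by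
    have hsub : Measurable fun x : ℕ × ℕ => x.1 - x.2 := measurable_of_countable _
    exact measurable_pi_lambda _ fun u =>
      hsub.comp ((hN.measurable (s' + u)).prodMk (hN.measurable s'))
  have h := hind.integral_fun_mul_eq_mul_integral (hψ.comp hpast).aestronglyMeasurable
    (hφ.comp hfut).aestronglyMeasurable
  have h0 : ∫ ω, (φ ∘ fun ω (u : ℝ≥0) => N (s' + u) ω - N s' ω) ω ∂P = 0 := by
    have := integral_of_hasLaw_poissonMeasure (hN.law s' t' hst')
    simpa only [φ, Function.comp_apply, add_tsub_cancel_of_le hst'] using this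
  rw [h0, mul_zero] at h
  rw [← h]
  refine integral_congr_ae (Eventually.of_forall fun ω => ?_)
  simp only [martingaleIncrement, occupation_eq, φ, ψ, Function.comp_apply,
    add_tsub_cancel_of_le hst']
  ring

/-- The martingale transform of the centered process `N` over the grid `ℕ / (n + 1)` up to the
time `T`. -/
def martingaleSum (M : ℝ≥0 → Ω → 𝓢) (N : ℝ≥0 → Ω → ℕ) (r : ℝ≥0) (S : 𝓢) (n T : ℕ) (ω : Ω) : ℝ :=
  ∑ k ∈ Finset.range (T * (n + 1)),
    martingaleIncrement M N r S ((k : ℝ≥0) / (n + 1)) (((k + 1 : ℕ) : ℝ≥0) / (n + 1)) ω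

lemma grid_mono (n : ℕ) {j k : ℕ} (h : j ≤ k) : (j : ℝ≥0) / (n + 1) ≤ (k : ℝ≥0) / (n + 1) := by
  gcongr

lemma grid_sub (n k : ℕ) : ((k + 1 : ℕ) : ℝ≥0) / (n + 1) - (k : ℝ≥0) / (n + 1) = 1 / (n + 1) := by
  rw [Nat.cast_succ, add_div, add_tsub_cancel_left]

/-- There are T(n + 1) orthogonal terms of second moment at most r/(n + 1), so the mesh cancels. -/
lemma LackOfAnticipation.integral_sq_martingaleSum_le (hLAA : LackOfAnticipation M N P)
    (hN : IsPoissonProcess N r P) (hM : ∀ t, Measurable (M t)) (n T : ℕ) :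
    ∫ ω, martingaleSum M N r S n T ω ^ 2 ∂P ≤ T * r := by
  have h := integral_sq_sum_le (P := P) (c := r * (1 / ((n : ℝ) + 1)))
    (fun k => hN.memLp_martingaleIncrement hM (S := S) (grid_mono n k.le_succ))
    (fun k => by
      refine (hN.integral_sq_martingaleIncrement_le hM (grid_mono n k.le_succ)).trans_eq ?_
      rw [grid_sub]
      push_cast
      rfl)
    (fun j k hjk => hLAA.integral_martingaleIncrement_mul hN hM (grid_mono n j.le_succ)
      (grid_mono n hjk) (grid_mono n k.le_succ)) (T * (n + 1))
  refine h.trans_eq ?_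
  push_cast
  have : ((n : ℝ) + 1) ≠ 0 := by positivity
  field_simp

lemma LackOfAnticipation.lintegral_sq_martingaleSum_le (hLAA : LackOfAnticipation M N P)
    (hN : IsPoissonProcess N r P) (hM : ∀ t, Measurable (M t)) (n T : ℕ) :
    ∫⁻ ω, ENNReal.ofReal (martingaleSum M N r S n T ω ^ 2) ∂P ≤ ENNReal.ofReal (T * r) := by
  have h : MemLp (martingaleSum M N r S n T) 2 P :=
    memLp_finsetSum _ fun k _ => hN.memLp_martingaleIncrement hM (grid_mono n k.le_succ)
  rw [← ofReal_integral_eq_lintegral_ofReal h.integrable_sq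
    (Eventually.of_forall fun _ => sq_nonneg _)]
  exact ENNReal.ofReal_le_ofReal (hLAA.integral_sq_martingaleSum_le hN hM n T)

lemma IsPoissonProcess.measurable_martingaleSum (hN : IsPoissonProcess N r P)
    (hM : ∀ t, Measurable (M t)) (n T : ℕ) : Measurable (martingaleSum M N r S n T) := by
  have hsub : Measurable fun x : ℕ × ℕ => ((x.1 - x.2 : ℕ) : ℝ) := measurable_of_countable _
  exact Finset.measurable_sum _ fun k _ => (measurable_occupation hM _).mul
    ((hsub.comp ((hN.measurable _).prodMk (hN.measurable _))).sub_const _)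

/-- The compensated number of arrivals up to `T` that find a path in the state `S`. -/
def compensatedArrivals (m : ℝ≥0 → 𝓢) (q : ℝ≥0 → ℕ) (r : ℝ≥0) (S : 𝓢) (T : ℕ) : ℝ :=
  ∫ u in Ioc 0 (T : ℝ≥0), occupation m S u ∂pathMeasure q -
    r * ∫ u in (0 : ℝ)..T, occupation m S u.toNNReal

lemma tendsto_martingaleSum {Ω 𝓢 : Type*} {M : ℝ≥0 → Ω → 𝓢} {N : ℝ≥0 → Ω → ℕ} {r : ℝ≥0}
    {S : 𝓢} {ω : Ω} (hm : LeftContinuousPath fun t => M t ω)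
    (hq : IsCountingPath fun t => N t ω) (T : ℕ) :
    Tendsto (fun n => martingaleSum M N r S n T ω) atTop
      (𝓝 (compensatedArrivals (fun t => M t ω) (fun t => N t ω) r S T)) := by
  refine ((tendsto_pathIntegral hm S hq T).sub
    ((tendsto_timeIntegral hm S T).const_mul (r : ℝ))).congr fun n => ?_
  rw [martingaleSum, Finset.mul_sum, ← Finset.sum_sub_distrib]
  refine Finset.sum_congr rfl fun k _ => ?_
  rw [martingaleIncrement, grid_sub]
  push_cast
  ring

/-! ### Almost sure convergence along squares -/

/-- Strong law along the squares for the compensated number of arrivals. -/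
lemma LackOfAnticipation.ae_tendsto_compensatedArrivals (hLAA : LackOfAnticipation M N P)
    (hN : IsPoissonProcess N r P) (hM : ∀ t, Measurable (M t))
    (hMpath : ∀ᵐ ω ∂P, LeftContinuousPath fun t => M t ω) :
    ∀ᵐ ω ∂P, Tendsto (fun n : ℕ =>
      compensatedArrivals (fun t => M t ω) (fun t => N t ω) r S ((n + 1) ^ 2) /
        ((n : ℝ) + 1) ^ 2) atTop (𝓝 0) := by
  -- This liminf is measurable by construction and almost surely equals D(T)², so measurability of
  -- the path integrals is never needed.
  let V : ℕ → Ω → ENNReal := fun T ω =>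
    liminf (fun n => ENNReal.ofReal (martingaleSum M N r S n T ω ^ 2)) atTop
  have hmeas : ∀ n T, Measurable fun ω => ENNReal.ofReal (martingaleSum M N r S n T ω ^ 2) :=
    fun n T => ((hN.measurable_martingaleSum hM n T).pow_const 2).ennreal_ofReal
  have hVmeas : ∀ T, Measurable (V T) := fun T => Measurable.liminf fun n => hmeas n T
  have hV : ∀ T : ℕ, ∫⁻ ω, V T ω ∂P ≤ ENNReal.ofReal (T * r) := fun T =>
    (lintegral_liminf_le fun n => hmeas n T).trans
      ((liminf_le_liminf (Eventually.of_forall fun n =>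
        hLAA.lintegral_sq_martingaleSum_le hN hM n T)).trans_eq (liminf_const _))
  let W : ℕ → Ω → ENNReal := fun n ω =>
    ENNReal.ofReal (1 / ((n : ℝ) + 1) ^ 4) * V ((n + 1) ^ 2) ω
  have hWmeas : ∀ n, Measurable (W n) := fun n => (hVmeas _).const_mul _
  have hW : ∀ n, ∫⁻ ω, W n ω ∂P ≤ ENNReal.ofReal (r * (1 / ((n : ℝ) + 1) ^ 2)) := by
    intro n
    rw [lintegral_const_mul _ (hVmeas _)]
    refine (mul_le_mul_right (hV _) _).trans_eq ?_
    rw [← ENNReal.ofReal_mul (by positivity)]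
    congr 1
    push_cast
    have : ((n : ℝ) + 1) ≠ 0 := by positivity
    field_simp
  have hsum : Summable fun n : ℕ => (r : ℝ) * (1 / ((n : ℝ) + 1) ^ 2) := by
    have := (summable_nat_add_iff 1).2 (Real.summable_one_div_nat_pow.2 one_lt_two)
    exact Summable.mul_left _ (by simpa using this)
  -- A finite expected sum makes the series converge almost surely, so its terms tend to 0.
  have hfin : ∫⁻ ω, ∑' n, W n ω ∂P ≠ ⊤ := by
    rw [lintegral_tsum fun n => (hWmeas n).aemeasurable]
    refine ne_top_of_le_ne_top ?_ (ENNReal.tsum_le_tsum hW)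
    exact hsum.tsum_ofReal_ne_top
  filter_upwards [ae_lt_top (Measurable.tsum hWmeas) hfin, hMpath, hN.path]
    with ω hω hm hq
  set D := fun T => compensatedArrivals (fun t => M t ω) (fun t => N t ω) r S T with hD
  have hVeq : ∀ T, V T ω = ENNReal.ofReal (D T ^ 2) := fun T =>
    Tendsto.liminf_eq (ENNReal.tendsto_ofReal ((tendsto_martingaleSum hm hq T).pow 2))
  have h0 := ENNReal.tendsto_atTop_zero_of_tsum_ne_top hω.ne
  have hWeq : ∀ n, W n ω = ENNReal.ofReal ((D ((n + 1) ^ 2) / ((n : ℝ) + 1) ^ 2) ^ 2) := by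
    intro n
    simp only [W]
    rw [hVeq, ← ENNReal.ofReal_mul (by positivity)]
    congr 1
    have : ((n : ℝ) + 1) ≠ 0 := by positivity
    field_simp
  simp only [hWeq] at h0
  have h1 := (ENNReal.tendsto_toReal ENNReal.zero_ne_top).comp h0
  have h2 : Tendsto (fun n : ℕ => (D ((n + 1) ^ 2) / ((n : ℝ) + 1) ^ 2) ^ 2) atTop (𝓝 0) := by
    refine h1.congr fun n => ?_
    exact ENNReal.toReal_ofReal (sq_nonneg _)
  have h3 := h2.sqrt
  simp only [Real.sqrt_sq_eq_abs, Real.sqrt_zero] at h3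
  exact (tendsto_zero_iff_abs_tendsto_zero _).2 h3

end

/-! ### From squares to all times -/

/-- With n² ≤ t ≤ (n + 1)², monotonicity squeezes A(t)/t between values at consecutive squares,
whose ratio tends to 1. -/
lemma tendsto_div_of_tendsto_div_sq {A : ℝ≥0 → ℝ} (hmono : Monotone A) (hnonneg : ∀ t, 0 ≤ A t)
    {L : ℝ} (hA : Tendsto (fun n : ℕ => A ((n : ℝ≥0) ^ 2) / (n : ℝ) ^ 2) atTop (𝓝 L)) :
    Tendsto (fun t : ℝ≥0 => 1 / (t : ℝ) * A t) atTop (𝓝 L) := by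
  have hratio : Tendsto (fun n : ℕ => (n : ℝ) / (n + 1)) atTop (𝓝 1) :=
    tendsto_natCast_div_add_atTop 1
  have hlow : Tendsto (fun n : ℕ => A ((n : ℝ≥0) ^ 2) / (n : ℝ) ^ 2 * ((n : ℝ) / (n + 1)) ^ 2) atTop
      (𝓝 L) := by
    simpa using hA.mul (hratio.pow 2)
  have hup : Tendsto (fun n : ℕ => A (((n + 1 : ℕ) : ℝ≥0) ^ 2) / ((n + 1 : ℕ) : ℝ) ^ 2 *
      (((n : ℝ) / (n + 1))⁻¹) ^ 2) atTop (𝓝 L) := by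
    simpa using ((tendsto_add_atTop_iff_nat 1).2 hA).mul ((hratio.inv₀ one_ne_zero).pow 2)
  have hfloor : Tendsto (fun t : ℝ≥0 => ⌊NNReal.sqrt t⌋₊) atTop atTop :=
    tendsto_nat_floor_atTop.comp NNReal.sqrt.tendsto_atTop
  refine tendsto_of_tendsto_of_tendsto_of_le_of_le' (hlow.comp hfloor) (hup.comp hfloor) ?_ ?_
  all_goals
    -- n ≥ 1 keeps the divisions by n² and t genuine.
    filter_upwards [hfloor.eventually_ge_atTop 1] with t ht
    simp only [Function.comp_apply]
    set n := ⌊NNReal.sqrt t⌋₊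
    have h1 : (n : ℝ≥0) ^ 2 ≤ t := NNReal.le_sqrt_iff_sq_le.1 (Nat.floor_le zero_le)
    have h2 : t ≤ ((n + 1 : ℕ) : ℝ≥0) ^ 2 := by
      refine NNReal.sqrt_le_iff_le_sq.1 ?_
      exact_mod_cast (Nat.lt_floor_add_one (NNReal.sqrt t)).le
    have hn : (0 : ℝ) < n := by exact_mod_cast ht
    have h1' : (n : ℝ) ^ 2 ≤ t := by exact_mod_cast NNReal.coe_le_coe.2 h1
    have h2' : (t : ℝ) ≤ ((n : ℝ) + 1) ^ 2 := by exact_mod_cast NNReal.coe_le_coe.2 h2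
    have ht' : (0 : ℝ) < t := lt_of_lt_of_le (by positivity) h1'
  · calc A ((n : ℝ≥0) ^ 2) / (n : ℝ) ^ 2 * ((n : ℝ) / (n + 1)) ^ 2
        = A ((n : ℝ≥0) ^ 2) / ((n : ℝ) + 1) ^ 2 := by field_simp
      _ ≤ A t / t := div_le_div₀ (hnonneg _) (hmono h1) ht' h2'
      _ = 1 / (t : ℝ) * A t := by ring
  · calc 1 / (t : ℝ) * A t = A t / t := by ring
      _ ≤ A (((n + 1 : ℕ) : ℝ≥0) ^ 2) / (n : ℝ) ^ 2 :=
        div_le_div₀ (hnonneg _) (hmono h2) (by positivity) h1'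
      _ = _ := by
        push_cast
        field_simp

lemma tendsto_arrivalFraction_of_compensatedArrivals {𝓢 : Type*} {m : ℝ≥0 → 𝓢} {S : 𝓢}
    (hm : LeftContinuousPath m) (q : ℝ≥0 → ℕ) {r : ℝ≥0} {p : ℝ}
    (htime : Tendsto (timeFraction m {S}) atTop (𝓝 p))
    (hD : Tendsto (fun n : ℕ => compensatedArrivals m q r S ((n + 1) ^ 2) / ((n : ℝ) + 1) ^ 2)
      atTop (𝓝 0)) :
    Tendsto (arrivalFraction m q {S}) atTop (𝓝 (r * p)) := by
  have hnonneg : ∀ t : ℝ≥0, 0 ≤ ∫ u in Ioc 0 t, occupation m S u ∂pathMeasure q :=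
    fun t => integral_nonneg fun u => occupation_nonneg m S u
  have hmono : Monotone fun t : ℝ≥0 => ∫ u in Ioc 0 t, occupation m S u ∂pathMeasure q :=
    fun s t hst => setIntegral_mono_set (integrableOn_occupation hm _ t)
      (Eventually.of_forall fun u => occupation_nonneg m S u)
      (Ioc_subset_Ioc_right hst).eventuallyLE
  refine tendsto_div_of_tendsto_div_sq hmono hnonneg ((tendsto_add_atTop_iff_nat 1).1 ?_)
  have hsq : Tendsto (fun n : ℕ => (((n + 1 : ℕ) : ℝ≥0)) ^ 2) atTop atTop :=
    (tendsto_pow_atTop two_ne_zero).comp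
      (tendsto_natCast_atTop_atTop.comp (tendsto_add_atTop_nat 1))
  have h := hD.add ((htime.comp hsq).const_mul (r : ℝ))
  rw [zero_add] at h
  refine h.congr fun n => ?_
  have hn : ((n : ℝ) + 1) ≠ 0 := by positivity
  simp only [compensatedArrivals, timeFraction, occupation, Function.comp_apply]
  push_cast
  field_simp
  ring

/-- PASTA for a single state. -/
lemma LackOfAnticipation.ae_tendsto_arrivalFraction {Ω 𝓢 : Type*} [MeasurableSpace Ω]
    {P : Measure Ω} [MeasurableSpace 𝓢] [MeasurableSingletonClass 𝓢]
    {M : ℝ≥0 → Ω → 𝓢} {N : ℝ≥0 → Ω → ℕ} {r : ℝ≥0} {S : 𝓢} {p : ℝ}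
    (hLAA : LackOfAnticipation M N P) (hN : IsPoissonProcess N r P) (hM : ∀ t, Measurable (M t))
    (hMpath : ∀ᵐ ω ∂P, LeftContinuousPath fun t => M t ω)
    (htime : ∀ᵐ ω ∂P, Tendsto (timeFraction (fun t => M t ω) {S}) atTop (𝓝 p)) :
    ∀ᵐ ω ∂P, Tendsto (arrivalFraction (fun t => M t ω) (fun t => N t ω) {S}) atTop
      (𝓝 (r * p)) := by
  filter_upwards [hLAA.ae_tendsto_compensatedArrivals hN hM hMpath (S := S), hMpath, htime]
    with ω hD hm ht
  exact tendsto_arrivalFraction_of_compensatedArrivals hm _ ht hD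

end

/-! ### Assembly over the states -/

theorem mainTheorem1 {Ω 𝓢 : Type*} [MeasurableSpace Ω] (P : Measure Ω) [IsProbabilityMeasure P]
    [Fintype 𝓢] [MeasurableSpace 𝓢] [MeasurableSingletonClass 𝓢]
    (M : ℝ≥0 → Ω → 𝓢) (hM : ∀ t, Measurable (M t))
    (hMpath : ∀ᵐ ω ∂P, LeftContinuousPath (fun t => M t ω))
    (π : 𝓢 → ℝ)
    (hlim : ∀ S, Tendsto (fun t : ℝ≥0 => P.real {ω | M t ω = S}) atTop (𝓝 (π S)))
    (htime : ∀ S, ∀ᵐ ω ∂P, Tendsto (timeFraction (fun t => M t ω) {S}) atTop (𝓝 (π S)))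
    (rate : 𝓢 → ℝ≥0) (N : 𝓢 → ℝ≥0 → Ω → ℕ)
    (hN : ∀ S, IsPoissonProcess (N S) (rate S) P)
    (hLAA : ∀ S, LackOfAnticipation M (N S) P)
    (Q : ℝ≥0 → Ω → ℕ) (hQpath : ∀ᵐ ω ∂P, IsCountingPath (fun t => Q t ω))
    (hQ : ∀ᵐ ω ∂P, JumpsCoincide (fun t => M t ω) (fun S t => N S t ω) (fun t => Q t ω))
    (B : Finset 𝓢) :
    (∀ᵐ ω ∂P, Tendsto (arrivalFraction (fun t => M t ω) (fun t => Q t ω) B) atTop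
      (𝓝 (∑ S ∈ B, (rate S : ℝ) * π S))) ∧
    ∀ (l : ℕ) (C : Fin l → Finset 𝓢) (c : Fin l → ℝ≥0),
      Pairwise (fun i j => Disjoint (C i) (C j)) → (⋃ i, (C i : Set 𝓢)) = B →
      (∀ i, ∀ S ∈ C i, rate S = c i) →
      ∀ᵐ ω ∂P, Tendsto (arrivalFraction (fun t => M t ω) (fun t => Q t ω) B) atTop
        (𝓝 (∑ i, (c i : ℝ) * ∑ S ∈ C i, π S)) := by
  have hmain : ∀ᵐ ω ∂P, Tendsto (arrivalFraction (fun t => M t ω) (fun t => Q t ω) B) atTop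
      (𝓝 (∑ S ∈ B, (rate S : ℝ) * π S)) := by
    -- Finitely many states: the exceptional null sets are merged without any joint information.
    have hS : ∀ᵐ ω ∂P, ∀ S, Tendsto (arrivalFraction (fun t => M t ω) (fun t => N S t ω) {S}) atTop
        (𝓝 (rate S * π S)) :=
      ae_all_iff.2 fun S => (hLAA S).ae_tendsto_arrivalFraction (hN S) hM hMpath (htime S)
    filter_upwards [hS, hMpath, hQpath, hQ, ae_all_iff.2 fun S => (hN S).path]
      with ω hS hm hq hc hp
    exact (tendsto_finsetSum B fun S _ => hS S).congr fun t =>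
      (arrivalFraction_eq_sum hc hq hp hm B t).symm
  refine ⟨hmain, fun l C c hdisj hunion hrate => ?_⟩
  have hsum : ∑ S ∈ B, (rate S : ℝ) * π S = ∑ i, (c i : ℝ) * ∑ S ∈ C i, π S := by
    classical
    have hB : B = Finset.univ.biUnion C := by
      ext S
      rw [← Finset.mem_coe, ← hunion]
      simp
    rw [hB, Finset.sum_biUnion fun i _ j _ hij => hdisj hij]
    refine Finset.sum_congr rfl fun i _ => ?_
    rw [Finset.mul_sum]
    exact Finset.sum_congr rfl fun S hS => by rw [hrate i S hS]
  rwa [hsum] at hmain
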